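/- Let $q$ be a prime power, let $n$ be a natural number, and let $Q$ be an ideal in the lattice of linear subspaces of $(\mathbb{F}_q)^n$, that is, a set of subspaces such that $A \in Q$ and $B \subseteq A$ imply $B \in Q$. For $0 \le k \le n$ let $\mu_k(Q)$ denote the fraction of the $k$-dimensional subspaces of $(\mathbb{F}_q)^n$ that belong to $Q$. (1) If $1 \le k \le n-1$ and $\mu_k(Q) = \frac{1}{1+z}$ with $z \in \mathbb{R}_{\ge 0}$, then $$\mu_{k-1}(Q) \ge \left(1+\frac{z}{q}\right)^{-1} \quad\text{and}\quad \mu_{k+1}(Q) \le (1+qz)^{-1}.$$ (2) There is an absolute constant $C > 0$ (independent of $q$, $n$, $Q$, $k$, $\varepsilon$) such that, for all $0 \le k \le n$ and $0 < \varepsilon \le 1$, if $\mu_k(Q) \le 1-\varepsilon$, then $\mu_\ell(Q) \le \varepsilon$ for every integer $\ell \le n$ with $\ell \ge k + C\log_q(1/\varepsilon)$. -/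

import Mathlib

universe u

/-- The set of `k`-dimensional linear subspaces of `F ^ n`. -/
def subspacesOfDim (F : Type*) [Field F] (n k : ℕ) : Set (Submodule F (Fin n → F)) :=
  {A | Module.finrank F A = k}

/-- The fraction of the `k`-dimensional subspaces of `F ^ n` that belong to `Q`
(used for finite `F` and `k ≤ n`, where the denominator is finite and positive). -/
noncomputable def density {F : Type*} [Field F] {n : ℕ}
    (k : ℕ) (Q : Set (Submodule F (Fin n → F))) : ℝ :=
  ((Q ∩ subspacesOfDim F n k).ncard : ℝ) / ((subspacesOfDim F n k).ncard : ℝ)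

/-!
The fractions `μ_d` of the `d`-dimensional subspaces in a lower set `Q` satisfy
`q μ_{d+1} (1 - μ_d) ≤ (1 - μ_{d+1}) μ_d` (`density_shadow`): the odds `(1 - μ) / μ` against
membership grow at least by a factor of `q` in each dimension. Both bounds of the first part are
restatements of this. In the second part the odds are at least `ε` in dimension `k`, hence at least
`q ^ (ℓ - k) ε ≥ 1 / ε` in dimension `ℓ` as soon as `ℓ - k ≥ 2 log_q (1 / ε)`; so `C = 2` will do.

The inequality is an instance of expander mixing. In the inclusion graph between `d`- and
`(d + 1)`-dimensional subspaces, no edge joins a `d`-dimensional subspace outside `Q` to a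
`(d + 1)`-dimensional subspace in `Q`; a spectral gap forces such a pair of sets to be small
(`card_mul_card_le_of_isLowerSet`). With `[m] = 1 + q + ⋯ + q ^ (m - 1)`, the squared norm of the
inclusion operator is `[d + 1] [n - d]`, attained at constants, but at most `q [d] [n - d - 1]` on
functions of mean zero (`sum_sq_sumBelow_le`). The ratio of the two is at most `1 / q`, because `q [m] ≤ [m + 1]`.

The spectral bound goes by induction on `d`. Two distinct `d`-dimensional subspaces have as many
common covers as common hyperplanes, so going up and then down in the lattice differs from going
down and then up only by the scalar `[n - d] - [d]` (`sum_sq_sumBelow`); and the operator going down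
has the same norm as its adjoint, which is the operator of the preceding dimension.
-/

section ShadowInequality

open Module Finset
open scoped Classical

/-! ### Counting subspaces -/

/-- The finite set of all `d`-dimensional subspaces of a finite vector space `V`. -/
noncomputable def grassmannian (F V : Type*) [Field F] [AddCommGroup V] [Module F V] [Finite V]
    (d : ℕ) : Finset (Submodule F V) :=
  (Set.toFinite {A : Submodule F V | finrank F A = d}).toFinset

/-- The `q`-integer `[m] = 1 + q + ⋯ + q ^ (m - 1)`, with values in `ℝ`. -/
def qInt (q : ℝ) (m : ℕ) : ℝ := ∑ i ∈ range m, q ^ i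

theorem qInt_succ (q : ℝ) (m : ℕ) : qInt q (m + 1) = q * qInt q m + 1 := by
  simp [qInt, Finset.sum_range_succ', Finset.mul_sum, pow_succ, mul_comm]

theorem qInt_nonneg {q : ℝ} (hq : 0 ≤ q) (m : ℕ) : 0 ≤ qInt q m :=
  Finset.sum_nonneg fun _ _ => pow_nonneg hq _

variable {F V : Type*} [Field F] [AddCommGroup V] [Module F V] [Finite V]

@[simp]
theorem mem_grassmannian {d : ℕ} {A : Submodule F V} :
    A ∈ grassmannian F V d ↔ finrank F A = d := by
  simp [grassmannian]

variable [Finite F]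

theorem card_submodule_finrank_one (W : Type*) [AddCommGroup W] [Module F W] {m : ℕ}
    (h : finrank F W = m) :
    (Nat.card {H : Submodule F W // finrank F H = 1} : ℝ) = qInt (Nat.card F) m := by
  rw [← Nat.card_congr (Projectivization.equivSubmodule F W),
    Projectivization.card_of_finrank F W h]
  simp [qInt]

/-- The covers of `A` correspond to the lines of `V ⧸ A`. -/
theorem card_covers {d : ℕ} {A : Submodule F V} (hA : A ∈ grassmannian F V d) :
    (#{C ∈ grassmannian F V (d + 1) | A ≤ C} : ℝ) = qInt (Nat.card F) (finrank F V - d) := by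
  rw [mem_grassmannian] at hA
  have hq : finrank F (V ⧸ A) = finrank F V - d := by
    have := A.finrank_quotient_add_finrank
    omega
  have hcomap (H : Submodule F (V ⧸ A)) :
      finrank F (H.comap A.mkQ) = finrank F H + d := by
    have e := Submodule.quotientQuotientEquivQuotient A (H.comap A.mkQ) (A.le_comap_mkQ H)
    rw [Submodule.map_comap_eq_self (by simp)] at e
    have h1 := e.finrank_eq
    have h2 := H.finrank_quotient_add_finrank
    have h3 := (H.comap A.mkQ).finrank_quotient_add_finrank
    have h4 := A.finrank_quotient_add_finrank
    omega
  rw [← card_submodule_finrank_one (V ⧸ A) hq, ← Nat.card_eq_finsetCard]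
  refine congrArg Nat.cast (Nat.card_congr
    { toFun := fun C => ⟨C.1.map A.mkQ, ?_⟩
      invFun := fun H => ⟨H.1.comap A.mkQ, ?_⟩
      left_inv := fun C => Subtype.ext ?_
      right_inv := fun H => Subtype.ext ?_ })
  · obtain ⟨C, hC⟩ := C
    simp only [mem_filter, mem_grassmannian] at hC
    have h := hcomap (C.map A.mkQ)
    rw [Submodule.comap_map_mkQ, sup_eq_right.2 hC.2] at h
    change finrank F (C.map A.mkQ) = 1
    omega
  · simp only [mem_filter, mem_grassmannian]
    exact ⟨by rw [hcomap, H.2, add_comm], A.le_comap_mkQ H.1⟩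
  · have hC := (mem_filter.1 C.2).2
    simp [Submodule.comap_map_mkQ, hC]
  · exact Submodule.map_comap_eq_self (by simp)

/-- The hyperplanes of `C` correspond to the lines of the dual of `C`. -/
theorem card_hyperplanes {d : ℕ} {C : Submodule F V} (hC : C ∈ grassmannian F V (d + 1)) :
    (#{A ∈ grassmannian F V d | A ≤ C} : ℝ) = qInt (Nat.card F) (d + 1) := by
  rw [mem_grassmannian] at hC
  have hD : finrank F (Dual F C) = d + 1 := by rw [Subspace.dual_finrank_eq, hC]
  have hann (B : Submodule F C) : finrank F B + finrank F B.dualAnnihilator = d + 1 := by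
    rw [← hC]
    exact Subspace.finrank_add_finrank_dualAnnihilator_eq B
  rw [← card_submodule_finrank_one (Dual F C) hD, ← Nat.card_eq_finsetCard]
  refine congrArg Nat.cast (Nat.card_congr
    { toFun := fun A => ⟨(A.1.comap C.subtype).dualAnnihilator, ?_⟩
      invFun := fun L => ⟨L.1.dualCoannihilator.map C.subtype, ?_⟩
      left_inv := fun A => Subtype.ext ?_
      right_inv := fun L => Subtype.ext ?_ })
  · obtain ⟨A, hA⟩ := A
    simp only [mem_filter, mem_grassmannian] at hA
    have h := hann (A.comap C.subtype)
    have h' := (Submodule.comapSubtypeEquivOfLe hA.2).finrank_eq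
    change finrank F (A.comap C.subtype).dualAnnihilator = 1
    omega
  · simp only [mem_filter, mem_grassmannian]
    refine ⟨?_, Submodule.map_subtype_le C _⟩
    have h := hann L.1.dualCoannihilator
    rw [Subspace.dualCoannihilator_dualAnnihilator_eq, L.2] at h
    rw [Submodule.finrank_map_subtype_eq]
    omega
  · have hA := (mem_filter.1 A.2).2
    simp [Subspace.dualAnnihilator_dualCoannihilator_eq, Submodule.map_comap_subtype, hA]
  · change (Submodule.comap C.subtype (Submodule.map C.subtype _)).dualAnnihilator = L.1
    rw [Submodule.comap_map_eq_of_injective C.injective_subtype,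
      Subspace.dualCoannihilator_dualAnnihilator_eq]

omit [Finite F] in
/-- Two distinct `(d + 1)`-dimensional subspaces have a common cover if and only if they have a
common hyperplane, and both are then unique, being `A ⊔ B` and `A ⊓ B`. -/
theorem card_common_covers_eq_card_common_hyperplanes {d : ℕ} {A B : Submodule F V}
    (hA : A ∈ grassmannian F V (d + 1)) (hB : B ∈ grassmannian F V (d + 1)) (hAB : A ≠ B) :
    #{C ∈ grassmannian F V (d + 2) | A ≤ C ∧ B ≤ C} =
      #{E ∈ grassmannian F V d | E ≤ A ∧ E ≤ B} := by
  rw [mem_grassmannian] at hA hB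
  have hsum := Submodule.finrank_sup_add_finrank_inf_eq A B
  have hlt : finrank F ↥(A ⊓ B) < d + 1 := by
    by_contra! h
    have h1 : A ⊓ B = A := Submodule.eq_of_le_of_finrank_le inf_le_left (by omega)
    have h2 : A ⊓ B = B := Submodule.eq_of_le_of_finrank_le inf_le_right (by omega)
    exact hAB (h1.symm.trans h2)
  by_cases h : finrank F ↥(A ⊓ B) = d
  · have h1 : {C ∈ grassmannian F V (d + 2) | A ≤ C ∧ B ≤ C} = {A ⊔ B} := by
      ext C
      simp only [mem_filter, mem_grassmannian, mem_singleton]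
      constructor
      · rintro ⟨hC, hAC⟩
        exact (Submodule.eq_of_le_of_finrank_le (sup_le hAC.1 hAC.2) (by omega)).symm
      · rintro rfl
        exact ⟨by omega, le_sup_left, le_sup_right⟩
    have h2 : {E ∈ grassmannian F V d | E ≤ A ∧ E ≤ B} = {A ⊓ B} := by
      ext E
      simp only [mem_filter, mem_grassmannian, mem_singleton]
      constructor
      · rintro ⟨hE, hEA⟩
        exact Submodule.eq_of_le_of_finrank_le (le_inf hEA.1 hEA.2) (by omega)
      · rintro rfl
        exact ⟨h, inf_le_left, inf_le_right⟩
    rw [h1, h2, card_singleton, card_singleton]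
  · have h1 : {C ∈ grassmannian F V (d + 2) | A ≤ C ∧ B ≤ C} = ∅ := by
      refine filter_eq_empty_iff.2 fun C hC hAC => ?_
      have := Submodule.finrank_mono (sup_le hAC.1 hAC.2)
      rw [mem_grassmannian] at hC
      omega
    have h2 : {E ∈ grassmannian F V d | E ≤ A ∧ E ≤ B} = ∅ := by
      refine filter_eq_empty_iff.2 fun E hE hEA => ?_
      have := Submodule.finrank_mono (le_inf hEA.1 hEA.2)
      rw [mem_grassmannian] at hE
      omega
    rw [h1, h2]

/-! ### The spectral gap of the inclusion operators -/

/-- The inclusion operator: `sumBelow d f C` is the sum of `f` over the `d`-dimensional subspaces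
of `C`. -/
noncomputable def sumBelow (d : ℕ) (f : Submodule F V → ℝ) (C : Submodule F V) : ℝ :=
  ∑ A ∈ grassmannian F V d with A ≤ C, f A

/-- The adjoint inclusion operator: `sumAbove d f E` is the sum of `f` over the `d`-dimensional
subspaces containing `E`. -/
noncomputable def sumAbove (d : ℕ) (f : Submodule F V → ℝ) (E : Submodule F V) : ℝ :=
  ∑ A ∈ grassmannian F V d with E ≤ A, f A

theorem sum_sq_sum_filter {α β : Type*} (s : Finset α) (t : Finset β) (r : β → α → Prop)
    (f : α → ℝ) :
    ∑ c ∈ t, (∑ a ∈ s with r c a, f a) ^ 2 =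
      ∑ a ∈ s, ∑ b ∈ s, (#{c ∈ t | r c a ∧ r c b} : ℝ) * (f a * f b) := by
  calc ∑ c ∈ t, (∑ a ∈ s with r c a, f a) ^ 2
      = ∑ c ∈ t, ∑ a ∈ s, ∑ b ∈ s, if r c a ∧ r c b then f a * f b else 0 := by
        refine Finset.sum_congr rfl fun c _ => ?_
        rw [sq, Finset.sum_filter, Finset.sum_mul_sum]
        refine Finset.sum_congr rfl fun a _ => Finset.sum_congr rfl fun b _ => ?_
        split_ifs <;> simp_all
    _ = _ := by
        rw [Finset.sum_comm]
        refine Finset.sum_congr rfl fun a _ => ?_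
        rw [Finset.sum_comm]
        refine Finset.sum_congr rfl fun b _ => ?_
        rw [← Finset.sum_filter, Finset.sum_const, nsmul_eq_mul]

omit [Finite F] in
/-- The two inclusion operators are adjoint to each other. -/
theorem sum_mul_sumBelow (d e : ℕ) (f g : Submodule F V → ℝ) :
    ∑ C ∈ grassmannian F V e, g C * sumBelow d f C =
      ∑ A ∈ grassmannian F V d, sumAbove e g A * f A := by
  simp_rw [sumBelow, sumAbove, Finset.sum_filter, Finset.mul_sum, Finset.sum_mul]
  rw [Finset.sum_comm]
  simp

/-- The commutation relation between the two inclusion operators, as an identity of quadratic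
forms: going up and then down differs from going down and then up only on the diagonal, where the
numbers of covers and of hyperplanes enter. -/
theorem sum_sq_sumBelow (d : ℕ) (f : Submodule F V → ℝ) :
    ∑ C ∈ grassmannian F V (d + 2), sumBelow (d + 1) f C ^ 2 =
      ∑ E ∈ grassmannian F V d, sumAbove (d + 1) f E ^ 2 +
        (qInt (Nat.card F) (finrank F V - (d + 1)) - qInt (Nat.card F) (d + 1)) *
          ∑ A ∈ grassmannian F V (d + 1), f A ^ 2 := by
  simp only [sumBelow, sumAbove]
  rw [sum_sq_sum_filter _ _ (fun C A => A ≤ C), sum_sq_sum_filter _ _ (fun E A => E ≤ A),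
    Finset.mul_sum, ← Finset.sum_add_distrib]
  refine Finset.sum_congr rfl fun A hA => ?_
  rw [← Finset.add_sum_erase _ _ hA, ← Finset.add_sum_erase _ _ hA]
  have hoff : ∀ B ∈ (grassmannian F V (d + 1)).erase A,
      (#{C ∈ grassmannian F V (d + 2) | A ≤ C ∧ B ≤ C} : ℝ) * (f A * f B) =
        (#{E ∈ grassmannian F V d | E ≤ A ∧ E ≤ B} : ℝ) * (f A * f B) := by
    intro B hB
    rw [card_common_covers_eq_card_common_hyperplanes hA (mem_of_mem_erase hB)
      (ne_of_mem_erase hB).symm]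
  rw [Finset.sum_congr rfl hoff]
  simp only [and_self]
  rw [card_covers hA, card_hyperplanes hA]
  ring

theorem sum_sumBelow (d : ℕ) (f : Submodule F V → ℝ) :
    ∑ C ∈ grassmannian F V (d + 1), sumBelow d f C =
      qInt (Nat.card F) (finrank F V - d) * ∑ A ∈ grassmannian F V d, f A := by
  have h := sum_mul_sumBelow d (d + 1) f (fun _ => 1)
  simp only [one_mul] at h
  rw [h, Finset.mul_sum]
  refine Finset.sum_congr rfl fun A hA => ?_
  rw [sumAbove, Finset.sum_const, nsmul_one, card_covers hA]

theorem sum_sumAbove (d : ℕ) (f : Submodule F V → ℝ) :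
    ∑ E ∈ grassmannian F V d, sumAbove (d + 1) f E =
      qInt (Nat.card F) (d + 1) * ∑ A ∈ grassmannian F V (d + 1), f A := by
  have h := sum_mul_sumBelow d (d + 1) (fun _ => 1) f
  simp only [mul_one] at h
  rw [← h, Finset.mul_sum]
  refine Finset.sum_congr rfl fun A hA => ?_
  rw [sumBelow, Finset.sum_const, nsmul_one, card_hyperplanes hA, mul_comm]

/-- On functions of mean zero, the squared norm of the inclusion operator is at most
`q [d] [n - d - 1]`, to be compared with the value `[d + 1] [n - d]` attained at constants. -/
theorem sum_sq_sumBelow_le (d : ℕ) (hd : d + 1 ≤ finrank F V) (f : Submodule F V → ℝ)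
    (hf : ∑ A ∈ grassmannian F V d, f A = 0) :
    ∑ C ∈ grassmannian F V (d + 1), sumBelow d f C ^ 2 ≤
      (Nat.card F : ℝ) * qInt (Nat.card F) d * qInt (Nat.card F) (finrank F V - (d + 1)) *
        ∑ A ∈ grassmannian F V d, f A ^ 2 := by
  induction d generalizing f with
  | zero =>
    -- there is only one zero-dimensional subspace, so a function of mean zero vanishes there
    have h0 : grassmannian F V 0 = {⊥} := by ext A; simp
    have hb : f ⊥ = 0 := by simpa [h0] using hf
    simp [sumBelow, h0, hb, Finset.sum_filter]
  | succ d ih =>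
    set q : ℝ := (Nat.card F : ℝ)
    set c : ℝ := q * qInt q d * qInt q (finrank F V - (d + 1)) with hc
    have hq : 0 ≤ q := Nat.cast_nonneg _
    set N : ℝ := ∑ A ∈ grassmannian F V (d + 1), f A ^ 2 with hN
    set M : ℝ := ∑ E ∈ grassmannian F V d, sumAbove (d + 1) f E ^ 2 with hM
    have hN0 : 0 ≤ N := Finset.sum_nonneg fun _ _ => sq_nonneg _
    have hc0 : 0 ≤ c := mul_nonneg (mul_nonneg hq (qInt_nonneg hq _)) (qInt_nonneg hq _)
    -- an operator and its adjoint have the same norm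
    have hadj : M ≤ c * N := by
      have hD := ih (by omega) (sumAbove (d + 1) f) (by rw [sum_sumAbove, hf, mul_zero])
      have hMM : M = ∑ A ∈ grassmannian F V (d + 1),
          f A * sumBelow d (sumAbove (d + 1) f) A := by
        rw [sum_mul_sumBelow, hM]
        exact Finset.sum_congr rfl fun _ _ => sq _
      have hcs : M ^ 2 ≤ N * (c * M) := by
        calc M ^ 2 ≤ N * ∑ A ∈ grassmannian F V (d + 1),
              sumBelow d (sumAbove (d + 1) f) A ^ 2 := by
              rw [hMM]
              exact sum_mul_sq_le_sq_mul_sq _ _ _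
          _ ≤ N * (c * M) := by gcongr
      have hM0 : 0 ≤ M := Finset.sum_nonneg fun _ _ => sq_nonneg _
      rcases hM0.eq_or_lt with h | h
      · rw [← h]
        positivity
      · exact le_of_mul_le_mul_right (by linarith) h
    rw [sum_sq_sumBelow]
    have h1 : qInt q (finrank F V - (d + 1)) = q * qInt q (finrank F V - (d + 1 + 1)) + 1 := by
      rw [← qInt_succ]
      congr 1
      omega
    have h2 := qInt_succ q d
    calc M + (qInt q (finrank F V - (d + 1)) - qInt q (d + 1)) * N
        ≤ c * N + (qInt q (finrank F V - (d + 1)) - qInt q (d + 1)) * N := by gcongr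
      _ = q * qInt q (d + 1) * qInt q (finrank F V - (d + 1 + 1)) * N := by
        rw [hc, h1, h2]
        ring

/-! ### The shadow inequality -/

theorem card_grassmannian_succ_mul (d : ℕ) :
    (#(grassmannian F V (d + 1)) : ℝ) * qInt (Nat.card F) (d + 1) =
      qInt (Nat.card F) (finrank F V - d) * #(grassmannian F V d) := by
  have h := sum_sumBelow (F := F) (V := V) d (fun _ => 1)
  simp only [sum_const, nsmul_one] at h
  rw [← h, ← nsmul_eq_mul, ← Finset.sum_const]
  refine Finset.sum_congr rfl fun A hA => ?_
  rw [sumBelow, Finset.sum_const, nsmul_one, card_hyperplanes hA]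

omit [Finite F] in
theorem grassmannian_nonempty {d : ℕ} (hd : d ≤ finrank F V) : (grassmannian F V d).Nonempty := by
  obtain ⟨s, hs, hli⟩ := exists_finset_linearIndependent_of_le_finrank (R := F) hd
  exact ⟨Submodule.span F s, by simpa [hs] using finrank_span_finset_eq_card hli⟩

/-- Expander mixing for the inclusion graph between the `d`- and the `(d + 1)`-dimensional
subspaces: no edge joins a `d`-dimensional subspace outside the lower set `Q` to a
`(d + 1)`-dimensional subspace in `Q`, so these two sets cannot both be large. -/
theorem card_mul_card_le_of_isLowerSet {Q : Set (Submodule F V)} (hQ : IsLowerSet Q) {d : ℕ}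
    (hd : d + 1 ≤ finrank F V) :
    (Nat.card F : ℝ) * #{C ∈ grassmannian F V (d + 1) | C ∈ Q} *
        #{A ∈ grassmannian F V d | A ∉ Q} ≤
      #{C ∈ grassmannian F V (d + 1) | C ∉ Q} * #{A ∈ grassmannian F V d | A ∈ Q} := by
  set q : ℝ := (Nat.card F : ℝ)
  have hq : 0 ≤ q := Nat.cast_nonneg _
  set P : ℝ := (#{C ∈ grassmannian F V (d + 1) | C ∈ Q} : ℝ)
  set R : ℝ := (#{C ∈ grassmannian F V (d + 1) | C ∉ Q} : ℝ)
  set s : ℝ := (#{A ∈ grassmannian F V d | A ∉ Q} : ℝ) with hs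
  set t : ℝ := (#{A ∈ grassmannian F V d | A ∈ Q} : ℝ) with ht
  have hP : 0 ≤ P := Nat.cast_nonneg _
  have hR : 0 ≤ R := Nat.cast_nonneg _
  have ht0 : 0 ≤ t := Nat.cast_nonneg _
  have hs_nonneg : 0 ≤ s := Nat.cast_nonneg _
  rcases hs_nonneg.eq_or_lt with hs0 | hs0
  · rw [← hs0, mul_zero]
    positivity
  have hPR : P + R = #(grassmannian F V (d + 1)) := by
    rw [← card_filter_add_card_filter_not (s := grassmannian F V (d + 1)) (· ∈ Q), Nat.cast_add]
  have hts : t + s = #(grassmannian F V d) := by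
    rw [← card_filter_add_card_filter_not (s := grassmannian F V d) (· ∈ Q), Nat.cast_add]
  set u : ℝ := qInt q (d + 1) with hu
  set v : ℝ := qInt q (finrank F V - d) with hv
  have hu' : u = q * qInt q d + 1 := qInt_succ q d
  have hv' : v = q * qInt q (finrank F V - (d + 1)) + 1 := by
    rw [← qInt_succ, hv]
    congr 1
    omega
  have ha := qInt_nonneg hq d
  have hb := qInt_nonneg hq (finrank F V - (d + 1))
  have hNuv : (P + R) * u = v * (t + s) := by
    rw [hPR, hts]
    exact card_grassmannian_succ_mul d
  -- the indicator of the complement of `Q`, shifted and scaled to have mean zero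
  let f : Submodule F V → ℝ := fun A => if A ∈ Q then -s else t
  have hf : ∑ A ∈ grassmannian F V d, f A = 0 := by
    simp only [f, Finset.sum_ite, Finset.sum_const, nsmul_eq_mul, ← hs, ← ht]
    ring
  have hf2 : ∑ A ∈ grassmannian F V d, f A ^ 2 = s * t * (t + s) := by
    simp only [f, ite_pow, Finset.sum_ite, Finset.sum_const, nsmul_eq_mul, ← hs, ← ht]
    ring
  have hT : ∀ C ∈ {C ∈ grassmannian F V (d + 1) | C ∈ Q}, sumBelow d f C = -(s * u) := by
    intro C hC
    rw [mem_filter] at hC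
    have hcongr : sumBelow d f C = ∑ A ∈ grassmannian F V d with A ≤ C, -s :=
      Finset.sum_congr rfl fun A hA => if_pos (hQ (mem_filter.1 hA).2 hC.2)
    rw [hcongr, Finset.sum_const, nsmul_eq_mul, card_hyperplanes hC.1]
    ring
  have hX := sum_sq_sumBelow_le d hd f hf
  have hsum := sum_sumBelow d f
  rw [hf, mul_zero, ← Finset.sum_filter_add_sum_filter_not _ (· ∈ Q), Finset.sum_congr rfl hT,
    Finset.sum_const, nsmul_eq_mul] at hsum
  rw [hf2, ← Finset.sum_filter_add_sum_filter_not _ (· ∈ Q),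
    Finset.sum_congr rfl (fun C hC => congrArg (· ^ 2) (hT C hC)),
    Finset.sum_const, nsmul_eq_mul] at hX
  have hcs := sq_sum_le_card_mul_sum_sq (s := {C ∈ grassmannian F V (d + 1) | C ∉ Q})
    (f := sumBelow d f)
  set Y : ℝ := ∑ C ∈ grassmannian F V (d + 1) with C ∉ Q, sumBelow d f C ^ 2
  set Z : ℝ := ∑ C ∈ grassmannian F V (d + 1) with C ∉ Q, sumBelow d f C
  change P * -(s * u) + Z = 0 at hsum
  change P * (-(s * u)) ^ 2 + Y ≤ _ at hX
  change Z ^ 2 ≤ R * Y at hcs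
  have hZ : Z = P * (s * u) := by linarith
  rw [hZ] at hcs
  set a := qInt q d
  set b := qInt q (finrank F V - (d + 1))
  have h1 : P * (s * u) ^ 2 * (P + R) ≤ R * (q * a * b * (s * t * (t + s))) := by
    calc P * (s * u) ^ 2 * (P + R) = (P * (s * u)) ^ 2 + R * (P * (-(s * u)) ^ 2) := by ring
      _ ≤ R * Y + R * (P * (-(s * u)) ^ 2) := by gcongr
      _ = R * (P * (-(s * u)) ^ 2 + Y) := by ring
      _ ≤ _ := by gcongr
  have h2 : (P * s * (u * v)) * (s * (t + s)) ≤ (R * (q * a * b) * t) * (s * (t + s)) := by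
    calc (P * s * (u * v)) * (s * (t + s)) = P * s ^ 2 * u * (v * (t + s)) := by ring
      _ = P * (s * u) ^ 2 * (P + R) := by rw [← hNuv]; ring
      _ ≤ _ := h1
      _ = _ := by ring
  have h3 : P * s * (u * v) ≤ R * (q * a * b) * t := le_of_mul_le_mul_right h2 (by positivity)
  have hu0 : 0 < u := by rw [hu']; positivity
  have hv0 : 0 < v := by rw [hv']; positivity
  refine le_of_mul_le_mul_right (a := u * v) ?_ (by positivity)
  calc q * P * s * (u * v) = q * (P * s * (u * v)) := by ring
    _ ≤ q * (R * (q * a * b) * t) := by gcongr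
    _ = R * t * ((q * a) * (q * b)) := by ring
    _ ≤ R * t * (u * v) := by
      gcongr
      · linarith
      · linarith

/-! ### Densities -/

theorem density_eq_div {n : ℕ} (k : ℕ) (Q : Set (Submodule F (Fin n → F))) :
    density k Q = (#{A ∈ grassmannian F (Fin n → F) k | A ∈ Q} : ℝ) /
      #(grassmannian F (Fin n → F) k) := by
  have h1 : Q ∩ subspacesOfDim F n k = ↑({A ∈ grassmannian F (Fin n → F) k | A ∈ Q}) := by
    ext A
    simp [subspacesOfDim, and_comm]
  have h2 : subspacesOfDim F n k = ↑(grassmannian F (Fin n → F) k) := by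
    ext A
    simp [subspacesOfDim]
  rw [density, h1, h2, Set.ncard_coe_finset, Set.ncard_coe_finset]

omit [Finite F] in
theorem density_nonneg {n : ℕ} (k : ℕ) (Q : Set (Submodule F (Fin n → F))) : 0 ≤ density k Q := by
  rw [density]
  positivity

/-- The odds `(1 - μ) / μ` against membership in a lower set grow at least by a factor of `q` from
one dimension to the next. The form free of division also covers zero densities. -/
theorem density_shadow {n : ℕ} {Q : Set (Submodule F (Fin n → F))} (hQ : IsLowerSet Q) {d : ℕ}
    (hd : d + 1 ≤ n) :
    (Nat.card F : ℝ) * density (d + 1) Q * (1 - density d Q) ≤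
      (1 - density (d + 1) Q) * density d Q := by
  have hn : finrank F (Fin n → F) = n := finrank_fin_fun F
  have h := card_mul_card_le_of_isLowerSet hQ (d := d) (by omega)
  have hN (k : ℕ) (hk : k ≤ n) : 0 < (#(grassmannian F (Fin n → F) k) : ℝ) := by
    exact_mod_cast (grassmannian_nonempty (by omega)).card_pos
  have hc (k : ℕ) (hk : k ≤ n) : 1 - density k Q =
      (#{A ∈ grassmannian F (Fin n → F) k | A ∉ Q} : ℝ) / #(grassmannian F (Fin n → F) k) := by
    have h := card_filter_add_card_filter_not (s := grassmannian F (Fin n → F) k) (· ∈ Q)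
    rw [density_eq_div, eq_div_iff (hN k hk).ne', sub_mul, div_mul_cancel₀ _ (hN k hk).ne',
      ← h]
    push_cast
    ring
  rw [hc d (by omega), hc (d + 1) hd, density_eq_div, density_eq_div, mul_assoc,
    div_mul_div_comm, div_mul_div_comm, ← mul_div_assoc, ← mul_assoc]
  gcongr

/-- The growth of the odds, for a lower bound `w` on the odds in dimension `d`. -/
theorem density_succ_mul_le_one {n : ℕ} {Q : Set (Submodule F (Fin n → F))} (hQ : IsLowerSet Q)
    {d : ℕ} (hd : d + 1 ≤ n) {w : ℝ} (h : density d Q * (1 + w) ≤ 1) :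
    density (d + 1) Q * (1 + Nat.card F * w) ≤ 1 := by
  have hs := density_shadow hQ hd
  have ha := density_nonneg (d + 1) Q
  have hq : (1 : ℝ) < Nat.card F := by exact_mod_cast Finite.one_lt_card
  set a := density (d + 1) Q
  set q : ℝ := (Nat.card F : ℝ)
  rcases (density_nonneg d Q).eq_or_lt with hb | hb
  · rw [← hb] at hs
    have : a = 0 := by nlinarith
    simp [this]
  · set b := density d Q
    have h1 : q * a * w * b ≤ (1 - a) * b := by
      calc q * a * w * b = q * a * (b * w) := by ring
        _ ≤ q * a * (1 - b) := by
          gcongr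
          linarith
        _ ≤ _ := hs
    have h2 := le_of_mul_le_mul_right h1 hb
    linarith

theorem density_add_mul_le_one {n : ℕ} {Q : Set (Submodule F (Fin n → F))} (hQ : IsLowerSet Q)
    {d : ℕ} {w : ℝ} (h : density d Q * (1 + w) ≤ 1) (m : ℕ) (hm : d + m ≤ n) :
    density (d + m) Q * (1 + (Nat.card F : ℝ) ^ m * w) ≤ 1 := by
  induction m with
  | zero => simpa using h
  | succ m ih =>
    have h1 := density_succ_mul_le_one hQ (d := d + m) (by omega) (ih (by omega))
    rwa [← mul_assoc, ← pow_succ'] at h1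

end ShadowInequality

theorem theorem2 :
    (∀ (F : Type u) [Field F] [Fintype F] (n : ℕ) (Q : Set (Submodule F (Fin n → F))),
      IsLowerSet Q →
      ∀ k : ℕ, 1 ≤ k → k + 1 ≤ n →
      ∀ z : ℝ, 0 ≤ z → density k Q = (1 + z)⁻¹ →
        (1 + z / (Fintype.card F : ℝ))⁻¹ ≤ density (k - 1) Q ∧
        density (k + 1) Q ≤ (1 + (Fintype.card F : ℝ) * z)⁻¹) ∧
    (∃ C : ℝ, 0 < C ∧
      ∀ (F : Type u) [Field F] [Fintype F] (n : ℕ) (Q : Set (Submodule F (Fin n → F))),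
        IsLowerSet Q →
        ∀ (k : ℕ) (ε : ℝ), k ≤ n → 0 < ε → ε ≤ 1 → density k Q ≤ 1 - ε →
        ∀ ℓ : ℕ, ℓ ≤ n →
          (k : ℝ) + C * Real.logb (Fintype.card F : ℝ) (1 / ε) ≤ (ℓ : ℝ) →
          density ℓ Q ≤ ε) := by
  refine ⟨?_, 2, two_pos, ?_⟩
  · intro F _ _ n Q hQ k hk hkn z hz hμ
    obtain ⟨d, rfl⟩ : ∃ d, k = d + 1 := ⟨k - 1, by omega⟩
    rw [← Nat.card_eq_fintype_card, Nat.add_sub_cancel]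
    have hq : (1 : ℝ) < Nat.card F := by exact_mod_cast Finite.one_lt_card
    have hz1 : 0 < 1 + z := by linarith
    constructor
    · have hs := density_shadow hQ (d := d) (by omega)
      rw [hμ] at hs
      set b := density d Q
      set q : ℝ := (Nat.card F : ℝ)
      have h1 : q * (1 - b) ≤ z * b := by
        calc q * (1 - b) = q * (1 + z)⁻¹ * (1 - b) * (1 + z) := by field_simp
          _ ≤ (1 - (1 + z)⁻¹) * b * (1 + z) := by gcongr
          _ = z * b := by field_simp; ring
      rw [inv_le_iff_one_le_mul₀ (by positivity)]
      have h2 : q * 1 ≤ q * (b * (1 + z / q)) := by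
        calc q * 1 ≤ q * b + z * b := by linarith
          _ = q * (b * (1 + z / q)) := by field_simp
      exact le_of_mul_le_mul_left h2 (by linarith)
    · have h := density_succ_mul_le_one hQ hkn (w := z) (by rw [hμ, inv_mul_cancel₀ hz1.ne'])
      rwa [← one_div, le_div_iff₀ (by positivity)]
  · intro F _ _ n Q hQ k ε hkn hε hε1 hμ ℓ hℓ hlog
    rw [← Nat.card_eq_fintype_card] at hlog
    have hq : (1 : ℝ) < Nat.card F := by exact_mod_cast Finite.one_lt_card
    set q : ℝ := (Nat.card F : ℝ) with hqdef
    have hlog0 : 0 ≤ Real.logb q (1 / ε) :=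
      Real.logb_nonneg hq (by rw [le_div_iff₀ hε]; linarith)
    have hkℓ : k ≤ ℓ := by
      have : (k : ℝ) ≤ ℓ := by linarith
      exact_mod_cast this
    obtain ⟨m, rfl⟩ := Nat.exists_eq_add_of_le hkℓ
    -- the odds against membership in `Q` are at least `ε` in dimension `k`
    have h := density_add_mul_le_one hQ (w := ε) (d := k) (by nlinarith) m hℓ
    rw [← hqdef] at h
    have hpow : (1 / ε) ^ 2 ≤ q ^ m := by
      rw [← Real.rpow_natCast q m, ← Real.logb_le_iff_le_rpow hq (by positivity), Real.logb_pow]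
      push_cast at hlog ⊢
      linarith
    have hε' : 1 / ε ≤ 1 + q ^ m * ε := by
      calc 1 / ε = (1 / ε) ^ 2 * ε := by field_simp
        _ ≤ q ^ m * ε := by gcongr
        _ ≤ _ := by linarith
    have h2 : density (k + m) Q * (1 / ε) ≤ 1 :=
      (mul_le_mul_of_nonneg_left hε' (density_nonneg _ Q)).trans h
    rwa [mul_one_div, div_le_one hε] at h2
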